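/- Throughout, $[x,y]=x^{-1}y^{-1}xy$ and $x^z=z^{-1}xz$, and $G'$ denotes the commutator subgroup of a group $G$. For a group $G$ let $G^*$ be a copy of $G$ with isomorphism $g\mapsto g^*$, and let $\nu(G)$ be the quotient of the free product $G\star G^*$ by the normal closure of all elements $[x,y^*]^{z}\,[x^z,(y^z)^*]^{-1}$ and $[x,y^*]^{(z^*)}\,[x^z,(y^z)^*]^{-1}$ with $x,y,z\in G$. Let $\nabla(G)=\langle [x,x^*] : x\in G\rangle\le\nu(G)$, which is a normal subgroup, and set $\tau(G)=\nu(G)/\nabla(G)$. For a group $G$ and an integer $m\ge 2$ let $K(G,m)=\{(g_1,\dots,g_m)\in G^m : g_1\cdots g_m\in G'\}$. For a free presentation $G\cong F/N$ (that is, $F$ is a free group and $N$ is the kernel of a surjective homomorphism $F\to G$) set $\tilde K(G,m)=K(F,m)/K(N,m)^{F^m}$, where $K(N,m)^{F^m}$ is the normal closure of $K(N,m)$ in $F^m$; up to isomorphism this does not depend on the presentation. **Proposition.** For every integer $n\ge 1$ let $$Q_{4n}=\langle a,b\mid a^{2n}=1,\ b^2=a^n,\ a^b=a^{-1}\rangle\quad\text{and}\quad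 D_{2n}=\langle a,b\mid a^n=1,\ b^2=1,\ a^b=a^{-1}\rangle$$ be the generalised quaternion group of order $4n$ and the dihedral group of order $2n$. Then $$\tau(Q_{4n})\cong\tilde K(Q_{4n},3)\quad\text{and}\quad \tau(D_{2n})\cong\tilde K(D_{2n},3),$$ where $\tilde K$ may be formed from any free presentation of the group concerned. -/

import Mathlib

/-! ### The groups `K(G, n)` and `K̃(G, n)` -/

/-- The homomorphism `Gⁿ → G / G'` sending a tuple to the product of its components modulo the
commutator subgroup `G'`. -/
def abProd (G : Type*) [Group G] (n : ℕ) : (Fin n → G) →* Abelianization G where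
  toFun g := ∏ i, Abelianization.of (g i)
  map_one' := by simp
  map_mul' g h := by simp [Finset.prod_mul_distrib]

/-- `K(G, n) = {(g₁, …, gₙ) ∈ Gⁿ : g₁ ⋯ gₙ ∈ G'}`, as a subgroup of `Gⁿ`. -/
def groupK (G : Type*) [Group G] (n : ℕ) : Subgroup (Fin n → G) :=
  (abProd G n).ker

theorem mem_groupK_iff {G : Type*} [Group G] {n : ℕ} (g : Fin n → G) :
    g ∈ groupK G n ↔ (List.ofFn g).prod ∈ commutator G := by
  have h : abProd G n g = Abelianization.of (List.ofFn g).prod := by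
    rw [map_list_prod, List.map_ofFn, List.prod_ofFn]
    rfl
  rw [groupK, MonoidHom.mem_ker, h, ← MonoidHom.mem_ker, Abelianization.ker_of]

/-- For a subgroup `N` of `F`, the image of `K(N, n) ≤ Nⁿ` in `Fⁿ`. The commutator subgroup used
here is the one of `N`. -/
def groupKSub {F : Type*} [Group F] (N : Subgroup F) (n : ℕ) : Subgroup (Fin n → F) :=
  (groupK N n).map (N.subtype.compLeft (Fin n))

/-- The normal closure of `K(N, n)` in `Fⁿ`. -/
def groupKRel {F : Type*} [Group F] (N : Subgroup F) (n : ℕ) : Subgroup (Fin n → F) :=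
  Subgroup.normalClosure (groupKSub N n : Set (Fin n → F))

instance groupKRel_normal {F : Type*} [Group F] (N : Subgroup F) (n : ℕ) :
    (groupKRel N n).Normal :=
  Subgroup.normalClosure_normal

/-- The normal closure of `K(N, n)` in `Fⁿ` lies in `K(F, n)`, so `KTilde` below is the quotient of
`K(F, n)` by all of it. -/
theorem groupKRel_le {F : Type*} [Group F] (N : Subgroup F) (n : ℕ) :
    groupKRel N n ≤ groupK F n := by
  have : (groupK F n).Normal := MonoidHom.normal_ker _
  refine Subgroup.normalClosure_le_normal ?_
  rintro _ ⟨g, hg, rfl⟩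
  have h := congrArg (Abelianization.map N.subtype) (show abProd N n g = 1 from hg)
  change abProd F n _ = 1
  simpa [abProd] using h

/-- `K̃(G, n) = K(F, n) / K(N, n)^(Fⁿ)`, for `π : F →* G` with kernel `N`. This is used for
surjective `π` with `F` free, that is, for a free presentation `G ≅ F / N`. -/
abbrev KTilde {F G : Type*} [Group F] [Group G] (π : F →* G) (n : ℕ) : Type _ :=
  groupK F n ⧸ (groupKRel π.ker n).subgroupOf (groupK F n)

/-! ### The groups `ν(G)` and `τ(G)` -/

/-- The commutator `[x, y] = x⁻¹ y⁻¹ x y`. -/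
def rcomm {G : Type*} [Group G] (x y : G) : G := x⁻¹ * y⁻¹ * x * y

/-- The conjugate `x ^ z = z⁻¹ x z`. -/
def rconj {G : Type*} [Group G] (x z : G) : G := z⁻¹ * x * z

/-- The relators `[x, y*]^z [x^z, (y^z)*]⁻¹` and `[x, y*]^(z*) [x^z, (y^z)*]⁻¹` of `ν(G)`. The copy
`G*` of `G` is the second factor of the free product, so `g` is `inl g` and `g*` is `inr g`. -/
def nuRel (G : Type*) [Group G] : Set (Monoid.Coprod G G) :=
  {w | ∃ x y z : G,
    w = rconj (rcomm (Monoid.Coprod.inl x) (Monoid.Coprod.inr y)) (Monoid.Coprod.inl z) *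
        (rcomm (Monoid.Coprod.inl (rconj x z)) (Monoid.Coprod.inr (rconj y z)))⁻¹ ∨
    w = rconj (rcomm (Monoid.Coprod.inl x) (Monoid.Coprod.inr y)) (Monoid.Coprod.inr z) *
        (rcomm (Monoid.Coprod.inl (rconj x z)) (Monoid.Coprod.inr (rconj y z)))⁻¹}

/-- `ν(G)`, the quotient of the free product of `G` and `G*` by the normal closure of `nuRel G`. -/
abbrev Nu (G : Type*) [Group G] : Type _ :=
  Monoid.Coprod G G ⧸ Subgroup.normalClosure (nuRel G)

/-- The homomorphism `G → ν(G)`, `g ↦ g`. -/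
def Nu.left (G : Type*) [Group G] : G →* Nu G :=
  (QuotientGroup.mk' _).comp Monoid.Coprod.inl

/-- The homomorphism `G → ν(G)`, `g ↦ g*`. -/
def Nu.right (G : Type*) [Group G] : G →* Nu G :=
  (QuotientGroup.mk' _).comp Monoid.Coprod.inr

theorem Nu.rconj_left {G : Type*} [Group G] (x y z : G) :
    rconj (rcomm (Nu.left G x) (Nu.right G y)) (Nu.left G z) =
      rcomm (Nu.left G (rconj x z)) (Nu.right G (rconj y z)) := by
  refine mul_inv_eq_one.mp ?_
  have h := (QuotientGroup.eq_one_iff _).mpr (Subgroup.subset_normalClosure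
    (show _ ∈ nuRel G from ⟨x, y, z, Or.inl rfl⟩))
  exact h

theorem Nu.rconj_right {G : Type*} [Group G] (x y z : G) :
    rconj (rcomm (Nu.left G x) (Nu.right G y)) (Nu.right G z) =
      rcomm (Nu.left G (rconj x z)) (Nu.right G (rconj y z)) := by
  refine mul_inv_eq_one.mp ?_
  have h := (QuotientGroup.eq_one_iff _).mpr (Subgroup.subset_normalClosure
    (show _ ∈ nuRel G from ⟨x, y, z, Or.inr rfl⟩))
  exact h

/-- `∇(G)`, the subgroup of `ν(G)` generated by the elements `[x, x*]`. -/
def nabla (G : Type*) [Group G] : Subgroup (Nu G) :=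
  Subgroup.closure {w | ∃ x : G, w = rcomm (Nu.left G x) (Nu.right G x)}

theorem nabla_conj_mem {G : Type*} [Group G] (u : Nu G)
    (hu : ∀ x : G, ∃ y : G, u * rcomm (Nu.left G x) (Nu.right G x) * u⁻¹ =
      rcomm (Nu.left G y) (Nu.right G y)) (w : Nu G) (hw : w ∈ nabla G) :
    u * w * u⁻¹ ∈ nabla G := by
  induction hw using Subgroup.closure_induction with
  | mem w hw =>
    obtain ⟨x, rfl⟩ := hw
    obtain ⟨y, hy⟩ := hu x
    rw [hy]
    exact Subgroup.subset_closure ⟨y, rfl⟩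
  | one => simp [one_mem]
  | mul a b _ _ ha hb =>
    have h := mul_mem ha hb
    rwa [show u * a * u⁻¹ * (u * b * u⁻¹) = u * (a * b) * u⁻¹ by group] at h
  | inv a _ ha =>
    have h := inv_mem ha
    rwa [show (u * a * u⁻¹)⁻¹ = u * a⁻¹ * u⁻¹ by group] at h

instance nabla_normal (G : Type*) [Group G] : (nabla G).Normal where
  conj_mem w hw u := by
    obtain ⟨v, rfl⟩ := QuotientGroup.mk_surjective u
    induction v using Monoid.Coprod.induction_on generalizing w with
    | inl z =>
      refine nabla_conj_mem (Nu.left G z) (fun x => ⟨rconj x z⁻¹, ?_⟩) w hw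
      rw [← Nu.rconj_left, rconj, map_inv, inv_inv]
    | inr z =>
      refine nabla_conj_mem (Nu.right G z) (fun x => ⟨rconj x z⁻¹, ?_⟩) w hw
      rw [← Nu.rconj_right, rconj, map_inv, inv_inv]
    | mul a b ha hb =>
      have h := ha _ (hb w hw)
      rw [QuotientGroup.mk_mul]
      simpa [mul_assoc] using h

/-- `τ(G) = ν(G) / ∇(G)`. -/
abbrev Tau (G : Type*) [Group G] : Type _ :=
  Nu G ⧸ nabla G

/-! Write `G = F / N` and `Q = F³ / K(N, 3)^(F³)`. The coordinate maps `ι i : F → Q` have commuting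
images and agree on `N`, so `N` has central image; `K̃(G, 3)` is the image of `K(F, 3)` in `Q`. Both
groups `G` are generated by `a`, `b` with `b ^ 2 = a ^ n` and `a ^ b = a⁻¹`, and have an
automorphism `φ` inverting `a` and `b`. Sending lifts `x` of `a`, `b` to `ι i x * ι 1 x⁻¹` respects
the defining relations and yields homomorphisms `l` (`i = 0`) and `r` (`i = 2`) from `G` to `Q`,
with values `ι i p * ι 1 q` at `g`, where `p` lies over `g` and `q` over `φ g`. Only coordinate `1`
contributes to `[l x, r y]`, so the relations of `τ(G)` hold and give `Φ : τ(G) → Q`.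

Its range is the image of `K(F, 3)`: modulo values of `l` and `r` such an element reduces to `ι 1`
of an element of `F'`, and commutators `[l x, r y]` generate `ι 1 (F')` (`range_eq`).

For injectivity, every element of `τ(G)` is `w ^ k * x * y*` with `w = [a, b*]` and `w ^ n = 1`
(`Tau.exists_normal_form`, `IsTauPair.pow_eq_one`). In the kernel `x = y = 1`, and it remains to
show that `ι 1 [a⁻¹, b⁻¹] ^ k = 1` forces `n ∣ k`. This is detected by a homomorphism `ψ` from `F`
to the quaternion group, in which `a ^ 2` has order `n`, with `ψ(N)` central: `π` itself for
`Q_{4n}`, and for `D_{2n}` a lift of `π` through the central extension `Q_{4n} → D_{2n}`. -/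

section CommutatorCalculus

variable {G : Type*} [Group G]

theorem rcomm_eq_one_iff {x y : G} : rcomm x y = 1 ↔ Commute x y := by
  rw [rcomm, mul_assoc, ← mul_inv_rev, inv_mul_eq_one, eq_comm]
  rfl

theorem rcomm_mul_left (x x' y : G) : rcomm (x * x') y = rconj (rcomm x y) x' * rcomm x' y := by
  simp only [rcomm, rconj]; group

theorem rcomm_mul_right (x y y' : G) : rcomm x (y * y') = rcomm x y' * rconj (rcomm x y) y' := by
  simp only [rcomm, rconj]; group

theorem map_rcomm {H : Type*} [Group H] (f : G →* H) (x y : G) :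
    f (rcomm x y) = rcomm (f x) (f y) := by
  simp [rcomm]

theorem map_rconj {H : Type*} [Group H] (f : G →* H) (x y : G) :
    f (rconj x y) = rconj (f x) (f y) := by
  simp [rconj]

theorem rconj_rcomm (x y z : G) : rconj (rcomm x y) z = rcomm (rconj x z) (rconj y z) := by
  simp only [rcomm, rconj]; group

theorem rconj_eq_self_iff {x y : G} : rconj x y = x ↔ Commute y x := by
  rw [rconj, mul_assoc, inv_mul_eq_iff_eq_mul, eq_comm]
  rfl

theorem rconj_mul (x y z : G) : rconj x (y * z) = rconj (rconj x y) z := by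
  simp only [rconj]; group

end CommutatorCalculus

theorem mem_of_closure_pair_eq_top {G : Type*} [Group G] {a b : G} (hgen : Subgroup.closure {a, b} = ⊤)
    (S : Subgroup G) (ha : a ∈ S)
    (hb : b ∈ S) (g : G) : g ∈ S := by
  have h1 : Subgroup.closure {a, b} ≤ S := by
    rw [Subgroup.closure_le]
    rintro _ (rfl | rfl)
    exacts [ha, hb]
  exact h1 (hgen ▸ Subgroup.mem_top g)

/-! ### Commutators and normal forms for a pair satisfying the relations of `τ(G)`. -/

/-- A pair of homomorphisms `G → T` satisfying the relations of the two canonical homomorphisms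
`G → τ(G)`. -/
structure IsTauPair {G T : Type*} [Group G] [Group T] (L R : G →* T) : Prop where
  rconj_left : ∀ x y z, rconj (rcomm (L x) (R y)) (L z) = rcomm (L (rconj x z)) (R (rconj y z))
  rconj_right : ∀ x y z, rconj (rcomm (L x) (R y)) (R z) = rcomm (L (rconj x z)) (R (rconj y z))
  rcomm_self : ∀ x, rcomm (L x) (R x) = 1

namespace IsTauPair

variable {G T : Type*} [Group G] [Group T] {L R : G →* T} {a b : G}

theorem commute_self (h : IsTauPair L R) (x : G) : Commute (L x) (R x) := rcomm_eq_one_iff.mp (h.rcomm_self x)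

/-- Since `b ^ a = b * a ^ 2` and `[a, (a ^ 2)*] = 1`, conjugating `[a, b*]` once by `a*` has the
same effect as doing so twice. Conjugation by `a` agrees with conjugation by `a*` here. -/
theorem rconj_a (h : IsTauPair L R) (hab : rconj a b = a⁻¹) :
    Commute (L a) (rcomm (L a) (R b)) ∧ Commute (R a) (rcomm (L a) (R b)) := by
  have e : rconj b a = b * (a * a) := by
    have h1 : b⁻¹ * a * b = a⁻¹ := hab
    have h2 : a * b = b * a⁻¹ := by rw [← h1]; group
    have h3 : a⁻¹ * b = b * a := by
      rw [inv_mul_eq_iff_eq_mul, ← mul_assoc, h2]; group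
    rw [rconj, h3, mul_assoc]
  have e1 : rconj a a = a := by simp [rconj]
  have h1 : rcomm (L a) (R (a * a)) = 1 := by
    rw [rcomm_eq_one_iff, map_mul]
    exact (h.commute_self a).mul_right (h.commute_self a)
  have hw : rconj (rcomm (L a) (R b)) (R a) =
      rconj (rconj (rcomm (L a) (R b)) (R a)) (R a) := by
    conv_lhs => rw [h.rconj_right, e1, e, map_mul, rcomm_mul_right, h1, one_mul, map_mul, rconj_mul]
  have hR : rconj (rcomm (L a) (R b)) (R a) = rcomm (L a) (R b) := by
    have := congrArg (fun t => R a * t * (R a)⁻¹) hw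
    simp only [rconj] at this ⊢
    group at this ⊢
    exact this.symm
  refine ⟨rconj_eq_self_iff.mp ?_, rconj_eq_self_iff.mp hR⟩
  rw [h.rconj_left, ← h.rconj_right, hR]

theorem rcomm_inv_left (h : IsTauPair L R) (hab : rconj a b = a⁻¹) :
    rcomm (L a⁻¹) (R b) = (rcomm (L a) (R b))⁻¹ := by
  have h1 := rcomm_mul_left (L a) (L a⁻¹) (R b)
  rw [← map_mul, mul_inv_cancel, map_one, rconj_eq_self_iff.mpr] at h1
  · rw [eq_inv_iff_mul_eq_one]
    have h2 : rcomm (L a) (R b) * rcomm (L a⁻¹) (R b) = 1 := by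
      rw [← h1]; simp [rcomm]
    exact mul_eq_one_comm.mp h2
  · rw [map_inv]
    exact (h.rconj_a hab).1.inv_left

theorem rconj_b (h : IsTauPair L R) (hab : rconj a b = a⁻¹) :
    rconj (rcomm (L a) (R b)) (L b) = (rcomm (L a) (R b))⁻¹ ∧
      rconj (rcomm (L a) (R b)) (R b) = (rcomm (L a) (R b))⁻¹ := by
  have e1 : rconj b b = b := by simp [rconj]
  rw [h.rconj_left, h.rconj_right, hab, e1, h.rcomm_inv_left hab]
  exact ⟨rfl, rfl⟩

theorem rcomm_pow_left (h : IsTauPair L R) (hab : rconj a b = a⁻¹) (k : ℕ) :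
    rcomm (L (a ^ k)) (R b) = rcomm (L a) (R b) ^ k := by
  induction k with
  | zero => simp [rcomm]
  | succ k ih =>
    rw [pow_succ, map_mul, rcomm_mul_left, ih, pow_succ, rconj_eq_self_iff.mpr]
    exact (h.rconj_a hab).1.pow_right k

/-- The power equals `[a ^ n, b*] = [b ^ 2, b*]`, and `b` commutes with `b*`. -/
theorem pow_eq_one (h : IsTauPair L R) (hab : rconj a b = a⁻¹) {n : ℕ} (hn : b ^ 2 = a ^ n) :
    rcomm (L a) (R b) ^ n = 1 := by
  rw [← h.rcomm_pow_left hab, ← hn, rcomm_eq_one_iff, map_pow]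
  exact (h.commute_self b).pow_left 2

/-- In the expansion of `[a * b, (a * b)*] = 1` only the two mixed commutators survive. -/
theorem rcomm_swap (h : IsTauPair L R) (hab : rconj a b = a⁻¹) : rcomm (L b) (R a) = (rcomm (L a) (R b))⁻¹ := by
  have h1 := h.rcomm_self (a * b)
  rw [map_mul, map_mul, rcomm_mul_left, rcomm_mul_right, rcomm_mul_right, h.rcomm_self, h.rcomm_self]
    at h1
  simp only [rconj] at h1
  have h2 : rconj (rcomm (L a) (R b)) (L b) * rconj (rcomm (L b) (R a)) (R b) = 1 := by
    simp only [rconj]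
    rw [← h1]; group
  rw [(h.rconj_b hab).1, ← (h.rconj_b hab).2] at h2
  simp only [rconj] at h2
  rw [eq_inv_iff_mul_eq_one]
  have h3 := congrArg (fun t => R b * t * (R b)⁻¹) h2
  have h4 : rcomm (L a) (R b) * rcomm (L b) (R a) = 1 := by
    simp only [mul_one, mul_inv_cancel] at h3
    rw [← h3]; group
  rw [eq_inv_of_mul_eq_one_right h4]
  group

theorem mem_normalizer_zpowers {w u : T} (hw : rconj w u = w ∨ rconj w u = w⁻¹) :
    u ∈ Subgroup.normalizer (Subgroup.zpowers w : Set T) := by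
  have h1 : u * w * u⁻¹ = w ∨ u * w * u⁻¹ = w⁻¹ := by
    simp only [rconj] at hw
    rcases hw with hw | hw
    · left
      nth_rw 1 [← hw]; group
    · right
      rw [← inv_eq_iff_eq_inv, conj_inv, ← hw]
      group
  rw [Subgroup.mem_normalizer_iff_map_conj_eq, MonoidHom.map_zpowers]
  change Subgroup.zpowers (u * w * u⁻¹) = _
  rcases h1 with h1 | h1 <;> simp [h1]

theorem mem_normalizer (h : IsTauPair L R) (hgen : Subgroup.closure {a, b} = ⊤)
    (hab : rconj a b = a⁻¹) (g : G) :
    L g ∈ Subgroup.normalizer (Subgroup.zpowers (rcomm (L a) (R b)) : Set T) ∧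
      R g ∈ Subgroup.normalizer (Subgroup.zpowers (rcomm (L a) (R b)) : Set T) := by
  have ha := h.rconj_a hab
  have hb := h.rconj_b hab
  constructor
  · refine mem_of_closure_pair_eq_top hgen (Subgroup.comap L (Subgroup.normalizer
      (Subgroup.zpowers (rcomm (L a) (R b)) : Set T))) ?_ ?_ g
    · exact mem_normalizer_zpowers (Or.inl (rconj_eq_self_iff.mpr ha.1))
    · exact mem_normalizer_zpowers (Or.inr hb.1)
  · refine mem_of_closure_pair_eq_top hgen (Subgroup.comap R (Subgroup.normalizer
      (Subgroup.zpowers (rcomm (L a) (R b)) : Set T))) ?_ ?_ g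
    · exact mem_normalizer_zpowers (Or.inl (rconj_eq_self_iff.mpr ha.2))
    · exact mem_normalizer_zpowers (Or.inr hb.2)

theorem rconj_mem_of_mem_normalizer {Z : Subgroup T} {u z : T}
    (hu : u ∈ Subgroup.normalizer (Z : Set T)) (hz : z ∈ Z) : rconj z u ∈ Z := by
  have := (Subgroup.mem_normalizer_iff.mp (inv_mem hu) z).mp hz
  rwa [inv_inv] at this

/-- Both images normalize the cyclic subgroup, so the commutator expansions stay inside it and
membership spreads from the generators, one argument at a time. -/
theorem rcomm_mem_zpowers (h : IsTauPair L R) (hgen : Subgroup.closure {a, b} = ⊤)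
    (hab : rconj a b = a⁻¹) (x y : G) :
    rcomm (L x) (R y) ∈ Subgroup.zpowers (rcomm (L a) (R b)) := by
  set Z := Subgroup.zpowers (rcomm (L a) (R b)) with hZ
  have hN := h.mem_normalizer hgen hab
  have left (y : G) (ha : rcomm (L a) (R y) ∈ Z) (hb : rcomm (L b) (R y) ∈ Z) (x : G) :
      rcomm (L x) (R y) ∈ Z := by
    refine mem_of_closure_pair_eq_top hgen
      { carrier := {x | rcomm (L x) (R y) ∈ Z}
        mul_mem' := fun {p q} hp hq => ?_
        one_mem' := by simp [rcomm]
        inv_mem' := fun {p} hp => ?_ } ha hb x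
    · change rcomm (L (p * q)) (R y) ∈ Z
      rw [map_mul, rcomm_mul_left]
      exact mul_mem (rconj_mem_of_mem_normalizer (hN q).1 hp) hq
    · change rcomm (L p⁻¹) (R y) ∈ Z
      have h1 := rcomm_mul_left (L p) (L p⁻¹) (R y)
      rw [← map_mul, mul_inv_cancel, map_one] at h1
      have h2 : rconj (rcomm (L p) (R y)) (L p⁻¹) * rcomm (L p⁻¹) (R y) ∈ Z := by
        rw [← h1]; simp [rcomm]
      exact (Subgroup.mul_mem_cancel_left _
        (rconj_mem_of_mem_normalizer (hN p⁻¹).1 hp)).mp h2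
  have right (x : G) (ha : rcomm (L x) (R a) ∈ Z) (hb : rcomm (L x) (R b) ∈ Z) (y : G) :
      rcomm (L x) (R y) ∈ Z := by
    refine mem_of_closure_pair_eq_top hgen
      { carrier := {y | rcomm (L x) (R y) ∈ Z}
        mul_mem' := fun {p q} hp hq => ?_
        one_mem' := by simp [rcomm]
        inv_mem' := fun {p} hp => ?_ } ha hb y
    · change rcomm (L x) (R (p * q)) ∈ Z
      rw [map_mul, rcomm_mul_right]
      exact mul_mem hq (rconj_mem_of_mem_normalizer (hN q).2 hp)
    · change rcomm (L x) (R p⁻¹) ∈ Z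
      have h1 := rcomm_mul_right (L x) (R p) (R p⁻¹)
      rw [← map_mul, mul_inv_cancel, map_one] at h1
      have h2 : rcomm (L x) (R p⁻¹) * rconj (rcomm (L x) (R p)) (R p⁻¹) ∈ Z := by
        rw [← h1]; simp [rcomm]
      exact (Subgroup.mul_mem_cancel_right _
        (rconj_mem_of_mem_normalizer (hN p⁻¹).2 hp)).mp h2
  have hw : rcomm (L a) (R b) ∈ Z := Subgroup.mem_zpowers _
  refine right x (left a ?_ ?_ x) (left b hw ?_ x) y
  · rw [h.rcomm_self]; exact one_mem _
  · rw [h.rcomm_swap hab]; exact inv_mem hw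
  · rw [h.rcomm_self]; exact one_mem _

theorem exists_normal_form_mul (h : IsTauPair L R) (hgen : Subgroup.closure {a, b} = ⊤)
    (hab : rconj a b = a⁻¹) {s t : T}
    (hs : ∃ z ∈ Subgroup.zpowers (rcomm (L a) (R b)), ∃ x y, s = z * L x * R y)
    (ht : ∃ z ∈ Subgroup.zpowers (rcomm (L a) (R b)), ∃ x y, t = z * L x * R y) :
    ∃ z ∈ Subgroup.zpowers (rcomm (L a) (R b)), ∃ x y, s * t = z * L x * R y := by
  obtain ⟨z, hz, x, y, rfl⟩ := hs
  obtain ⟨z', hz', x', y', rfl⟩ := ht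
  have hN := h.mem_normalizer hgen hab
  -- `h1` carries `z'` to the left past `L x * R y`; `h2` is the correction for interchanging `R y`
  -- and `L x'`, also carried to the left.
  have h1 := rconj_mem_of_mem_normalizer (mul_mem (inv_mem (hN y).2) (inv_mem (hN x).1)) hz'
  have h2 := rconj_mem_of_mem_normalizer (mul_mem (mul_mem (inv_mem (hN y).2)
    (inv_mem (hN x').1)) (inv_mem (hN x).1)) (inv_mem (h.rcomm_mem_zpowers hgen hab x' y))
  have h3 := (hN x').1
  refine ⟨_, mul_mem (mul_mem hz h1) h2, x * x', y * y', ?_⟩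
  simp only [rconj, rcomm, map_mul]
  group

end IsTauPair

/-! ### Maps from `G` into a group with three commuting images of `F`. -/

/-- Homomorphisms `F → Q` with commuting images which agree on the subgroup `N`. -/
structure IsCommutingTriple {F Q : Type*} [Group F] [Group Q] (N : Subgroup F)
    (ι : Fin 3 → F →* Q) : Prop where
  commute : ∀ i j, i ≠ j → ∀ x y, Commute (ι i x) (ι j y)
  agree : ∀ i j, ∀ m ∈ N, ι i m = ι j m

/-- The group `G` is presented by the generators `a`, `b` and the relations `a ^ p = 1`,
`b ^ 2 = a ^ n`, `a ^ b = a⁻¹`, as tested on groups in the universe `u`. -/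
structure IsDicyclicPresented.{u, v} {G : Type v} [Group G] (a b : G) (p n : ℕ) : Prop where
  closure : Subgroup.closure {a, b} = ⊤
  pow_eq_one : a ^ p = 1
  sq_eq : b ^ 2 = a ^ n
  conj_eq : rconj a b = a⁻¹
  exists_lift : ∀ {Q : Type u} [Group Q] (A B : Q), A ^ p = 1 → B ^ 2 = A ^ n →
    rconj A B = A⁻¹ → ∃ f : G →* Q, f a = A ∧ f b = B

namespace IsCommutingTriple

variable {F G Q : Type*} [Group F] [Group G] [Group Q]

/-- An element of `N` may be moved to a coordinate different from `j`. -/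
theorem commute_of_mem {N : Subgroup F} {ι : Fin 3 → F →* Q} (h : IsCommutingTriple N ι)
    (i j : Fin 3) {m : F} (hm : m ∈ N) (y : F) : Commute (ι i m) (ι j y) := by
  obtain ⟨k, hk⟩ : ∃ k : Fin 3, k ≠ j := exists_ne j
  rw [h.agree i k m hm]
  exact h.commute k j hk m y

theorem rcomm_congr {π : F →* G} {ι : Fin 3 → F →* Q} (h : IsCommutingTriple π.ker ι)
    (j : Fin 3) {q q' r r' : F} (hq : π q = π r) (hq' : π q' = π r') :
    ι j (rcomm q q') = ι j (rcomm r r') := by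
  obtain ⟨m, hm, rfl⟩ : ∃ m ∈ π.ker, q = r * m := ⟨r⁻¹ * q, by simp [hq], by group⟩
  obtain ⟨m', hm', rfl⟩ : ∃ m ∈ π.ker, q' = r' * m := ⟨r'⁻¹ * q', by simp [hq'], by group⟩
  have c1 : Commute (ι j m) (ι j (r' * m')) := h.commute_of_mem j j hm _
  have c2 : Commute (ι j r) (ι j m') := (h.commute_of_mem j j hm' _).symm
  rw [map_rcomm, map_rcomm, map_mul _ r m, rcomm_mul_left, rcomm_eq_one_iff.mpr c1, mul_one,
    map_mul, rcomm_mul_right, rcomm_eq_one_iff.mpr c2, one_mul, ← map_rcomm,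
    rconj_eq_self_iff.mpr (h.commute_of_mem j j hm' _), rconj_eq_self_iff.mpr
    (h.commute_of_mem j j hm _)]

/-- Each defining relation holds in `F` up to a factor in `N`. The factor enters through coordinates
`i` and `j` with opposite signs and cancels, since its image is central and the same in both. -/
theorem exists_hom.{u, v, w} {F : Type v} {G : Type w} {Q : Type u} [Group F] [Group G] [Group Q]
    {π : F →* G} {ι : Fin 3 → F →* Q}
    (h : IsCommutingTriple π.ker ι) {i j : Fin 3} (hij : i ≠ j) {a b : F} {p n : ℕ}
    (hG : IsDicyclicPresented.{u} (π a) (π b) p n) :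
    ∃ f : G →* Q, f (π a) = ι i a * ι j a⁻¹ ∧ f (π b) = ι i b * ι j b⁻¹ := by
  have hc := h.commute i j hij
  refine hG.exists_lift _ _ ?_ ?_ ?_
  · rw [(hc a a⁻¹).mul_pow, ← map_pow, ← map_pow, inv_pow, map_inv, h.agree i j (a ^ p),
      mul_inv_cancel]
    rw [MonoidHom.mem_ker, map_pow, hG.pow_eq_one]
  · obtain ⟨m, hm, hb⟩ : ∃ m ∈ π.ker, b ^ 2 = a ^ n * m :=
      ⟨(a ^ n)⁻¹ * b ^ 2, by simp [hG.sq_eq], by group⟩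
    rw [(hc a a⁻¹).mul_pow, (hc b b⁻¹).mul_pow, ← map_pow, ← map_pow, ← map_pow, ← map_pow, inv_pow,
      inv_pow, hb, mul_inv_rev, map_mul, map_mul, h.agree i j m hm, map_inv _ m]
    group
  · obtain ⟨m, hm, hb⟩ : ∃ m ∈ π.ker, rconj a b = a⁻¹ * m :=
      ⟨a * rconj a b, by simp [map_rconj, hG.conj_eq], by group⟩
    have h1 : rconj (ι i a * ι j a⁻¹) (ι i b * ι j b⁻¹) =
        ι i (rconj a b) * ι j (rconj a⁻¹ b⁻¹) := by
      simp only [rconj, mul_inv_rev]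
      have e1 := hc b a⁻¹
      have e2 := (hc (b⁻¹ * a * b) (b⁻¹⁻¹)).eq
      simp only [map_mul, map_inv, inv_inv] at e1 e2 ⊢
      calc ι j b * (ι i b)⁻¹ * (ι i a * (ι j a)⁻¹) * (ι i b * (ι j b)⁻¹)
          = ι j b * (ι i b)⁻¹ * ι i a * ((ι j a)⁻¹ * ι i b) * (ι j b)⁻¹ := by group
        _ = ι j b * (ι i b)⁻¹ * ι i a * (ι i b * (ι j a)⁻¹) * (ι j b)⁻¹ := by rw [e1.eq]
        _ = (ι j b * ((ι i b)⁻¹ * ι i a * ι i b)) * (ι j a)⁻¹ * (ι j b)⁻¹ := by group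
        _ = _ := by rw [← e2]; group
    -- In coordinate `j` the conjugation is by `b⁻¹`, which also inverts `a` modulo `N`.
    have h2 : rconj a⁻¹ b⁻¹ = a * (b * m⁻¹ * b⁻¹) := by
      have h3 : b * rconj a b * b⁻¹ = a := by simp only [rconj]; group
      rw [hb] at h3
      nth_rw 2 [← h3]
      simp only [rconj]; group
    have h4 : ι j (b * m⁻¹ * b⁻¹) = (ι i m)⁻¹ := by
      rw [h.agree i j m hm, ← map_inv, map_mul, map_mul,
        ← (h.commute_of_mem j j (inv_mem hm) b).eq, mul_assoc, ← map_mul, mul_inv_cancel, map_one,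
        mul_one]
    have h5 : Commute (ι i m) (ι j a) := h.commute i j hij m a
    rw [h1, hb, h2, map_mul _ a, h4, map_mul, mul_assoc, ← mul_assoc (ι i m), h5.eq, mul_assoc,
      mul_inv_cancel, mul_one, mul_inv_rev, ← map_inv, ← map_inv, inv_inv,
      (h.commute i j hij a⁻¹ a).eq]

theorem exists_form {π : F →* G} {ι : Fin 3 → F →* Q}
    (h : IsCommutingTriple π.ker ι) {i j : Fin 3} (hij : i ≠ j) {a b : F}
    (hgen : Subgroup.closure {π a, π b} = ⊤) {φ : G →* G} (ha : φ (π a) = (π a)⁻¹)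
    (hb : φ (π b) = (π b)⁻¹) {f : G →* Q} (hfa : f (π a) = ι i a * ι j a⁻¹)
    (hfb : f (π b) = ι i b * ι j b⁻¹) (g : G) :
    ∃ p q, f g = ι i p * ι j q ∧ π p = g ∧ π q = φ g ∧
      Abelianization.of p * Abelianization.of q = 1 := by
  refine mem_of_closure_pair_eq_top hgen
      { carrier := {g | ∃ p q, f g = ι i p * ι j q ∧ π p = g ∧ π q = φ g ∧
          Abelianization.of p * Abelianization.of q = 1}
        mul_mem' := ?_
        one_mem' := ⟨1, 1, by simp⟩
        inv_mem' := ?_ } ⟨a, a⁻¹, hfa, rfl, by simp [ha], by simp⟩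
        ⟨b, b⁻¹, hfb, rfl, by simp [hb], by simp⟩ g
  · rintro g g' ⟨p, q, h1, h2, h3, h4⟩ ⟨p', q', h1', h2', h3', h4'⟩
    refine ⟨p * p', q * q', ?_, by simp [h2, h2'], by simp [h3, h3'], ?_⟩
    · rw [map_mul, h1, h1', map_mul, map_mul, mul_assoc, mul_assoc, ← mul_assoc (ι j q),
        ← (h.commute i j hij p' q).eq, mul_assoc]
    · rw [map_mul, map_mul, mul_mul_mul_comm, h4, h4', one_mul]
  · rintro g ⟨p, q, h1, h2, h3, h4⟩
    refine ⟨p⁻¹, q⁻¹, ?_, by simp [h2], by simp [h3], ?_⟩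
    · rw [map_inv, h1, (h.commute i j hij p q).eq, mul_inv_rev, map_inv, map_inv]
    · rw [map_inv, map_inv, ← mul_inv, h4, inv_one]

end IsCommutingTriple

/-! ### Twisted diagonals and their commutators. -/

/-- The homomorphisms `f i` (`i ≠ 1`) have the form `g ↦ ι i p * ι 1 q` with `p` over `g` and `q`
over `φ g`. -/
structure IsTwistedDiagonal {F G Q : Type*} [Group F] [Group G] [Group Q] (π : F →* G)
    (ι : Fin 3 → F →* Q) (φ : G →* G) (i : Fin 3) (f : G →* Q) : Prop where
  exists_form : ∀ g, ∃ p q, f g = ι i p * ι 1 q ∧ π p = g ∧ π q = φ g ∧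
      Abelianization.of p * Abelianization.of q = 1

namespace IsTwistedDiagonal

variable {F G Q : Type*} [Group F] [Group G] [Group Q] {π : F →* G} {ι : Fin 3 → F →* Q}
  {φ : G →* G} {l r : G →* Q}

/-- Coordinates `0` and `2` each occur in one argument only, so they commute with the other argument
and drop out. Independence of the lifts is `rcomm_congr`. -/
theorem rcomm_eq (h : IsCommutingTriple π.ker ι) (hl : IsTwistedDiagonal π ι φ 0 l)
    (hr : IsTwistedDiagonal π ι φ 2 r) {x y : G} {q q' : F} (hq : π q = φ x) (hq' : π q' = φ y) :
    rcomm (l x) (r y) = ι 1 (rcomm q q') := by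
  obtain ⟨s, t, h1, -, h3, -⟩ := hl.exists_form x
  obtain ⟨s', t', h1', -, h3', -⟩ := hr.exists_form y
  rw [h.rcomm_congr 1 (hq.trans h3.symm) (hq'.trans h3'.symm), h1, h1', map_rcomm]
  have c1 : Commute (ι 0 s) (ι 2 s' * ι 1 t') :=
    (h.commute 0 2 (by decide) _ _).mul_right (h.commute 0 1 (by decide) _ _)
  have c2 : Commute (ι 1 t) (ι 2 s') := h.commute 1 2 (by decide) _ _
  have c3 : Commute (ι 1 t') (ι 2 s') := h.commute 1 2 (by decide) _ _
  have c4 : Commute (ι 1 t) (ι 0 s) := h.commute 1 0 (by decide) _ _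
  rw [← c4.eq, rcomm_mul_left, rcomm_eq_one_iff.mpr c1, mul_one, ← c3.eq, rcomm_mul_right,
    rcomm_eq_one_iff.mpr c2, one_mul, ← map_rcomm, rconj_eq_self_iff.mpr, rconj_eq_self_iff.mpr]
  · exact h.commute 2 1 (by decide) _ _
  · rw [rconj_eq_self_iff.mpr (h.commute 2 1 (by decide) _ _)]
    exact h.commute 0 1 (by decide) _ _

theorem rconj_eq (h : IsCommutingTriple π.ker ι) {i : Fin 3} (hi : i ≠ 1)
    (hl : IsTwistedDiagonal π ι φ i l) (z : G) :
    ∃ q, π q = φ z ∧ ∀ x, rconj (ι 1 x) (l z) = ι 1 (rconj x q) := by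
  obtain ⟨s, t, h1, -, h3, -⟩ := hl.exists_form z
  refine ⟨t, h3, fun x => ?_⟩
  rw [h1, rconj_mul, rconj_eq_self_iff.mpr (h.commute i 1 hi _ _), map_rconj]

theorem isTauPair (h : IsCommutingTriple π.ker ι) (hπ : Function.Surjective π)
    (hl : IsTwistedDiagonal π ι φ 0 l)
    (hr : IsTwistedDiagonal π ι φ 2 r) : IsTauPair l r := by
  constructor
  · intro x y z
    obtain ⟨p, hp⟩ := hπ (φ x)
    obtain ⟨q, hq⟩ := hπ (φ y)
    obtain ⟨s, hs, e⟩ := rconj_eq h (by decide) hl z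
    rw [rcomm_eq h hl hr hp hq, e, rconj_rcomm, rcomm_eq h hl hr] <;> simp [map_rconj, *]
  · intro x y z
    obtain ⟨p, hp⟩ := hπ (φ x)
    obtain ⟨q, hq⟩ := hπ (φ y)
    obtain ⟨s, hs, e⟩ := rconj_eq h (by decide) hr z
    rw [rcomm_eq h hl hr hp hq, e, rconj_rcomm, rcomm_eq h hl hr] <;> simp [map_rconj, *]
  · intro x
    obtain ⟨p, hp⟩ := hπ (φ x)
    rw [rcomm_eq h hl hr hp hp, rcomm_eq_one_iff.mpr (Commute.refl p), map_one]

end IsTwistedDiagonal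

/-! ### The quotient of `F³` and an invariant of its relations. -/

section Quotient

variable {F G H : Type*} [Group F] [Group G] [Group H]

/-- The `i`-th coordinate embedding `F → F³`, modulo the normal closure of `K(N, 3)`. -/
def coordHom (N : Subgroup F) (i : Fin 3) : F →* (Fin 3 → F) ⧸ groupKRel N 3 :=
  (QuotientGroup.mk' _).comp (MonoidHom.mulSingle (fun _ => F) i)

theorem abProd_mulSingle {n : ℕ} (i : Fin n) (x : G) :
    abProd G n (Pi.mulSingle i x) = Abelianization.of x := by
  change ∏ j, Abelianization.of (Pi.mulSingle i x j) = _
  rw [Finset.prod_eq_single i]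
  · simp
  · intro j _ hj
    simp [Pi.mulSingle_eq_of_ne hj]
  · simp

theorem isCommutingTriple_coordHom (N : Subgroup F) : IsCommutingTriple N (coordHom N) where
  commute i j hij x y :=
    (Pi.mulSingle_commute (f := fun _ => F) hij x y).map (QuotientGroup.mk' (groupKRel N 3))
  agree i j m hm := by
    refine inv_mul_eq_one.mp ?_
    refine (QuotientGroup.eq_one_iff ((Pi.mulSingle i m)⁻¹ * Pi.mulSingle j m : Fin 3 → F)).mpr
      (Subgroup.subset_normalClosure ?_)
    refine ⟨(Pi.mulSingle i ⟨m, hm⟩)⁻¹ * Pi.mulSingle j ⟨m, hm⟩, ?_, ?_⟩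
    · change abProd N 3 _ = 1
      rw [map_mul, map_inv, abProd_mulSingle, abProd_mulSingle, inv_mul_cancel]
    · rw [map_mul, map_inv]
      congr 1
      · congr 1
        ext k
        simp only [MonoidHom.compLeft_apply, Function.comp]
        rw [Pi.apply_mulSingle (fun _ => N.subtype) (fun _ => map_one _)]
        rfl
      · ext k
        simp only [MonoidHom.compLeft_apply, Function.comp]
        rw [Pi.apply_mulSingle (fun _ => N.subtype) (fun _ => map_one _)]
        rfl

theorem mk_eq_coordHom_mul (N : Subgroup F) (v : Fin 3 → F) :
    (v : (Fin 3 → F) ⧸ groupKRel N 3) =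
      coordHom N 0 (v 0) * coordHom N 1 (v 1) * coordHom N 2 (v 2) := by
  have : v = Pi.mulSingle 0 (v 0) * Pi.mulSingle 1 (v 1) * Pi.mulSingle 2 (v 2) := by
    ext i
    fin_cases i <;> simp [Pi.mulSingle, Function.update]
  conv_lhs => rw [this]
  rfl

/-- With `ψ(N)` central, the product of the `ψ (v i)` is a homomorphism on `N³`, unchanged by
conjugation in `F³`. It kills `K(N, 3)` because `ψ` on `N` factors through the abelianization of
`N`. -/
theorem groupKRel_le_of_map_ker_le_center {π : F →* G} (ψ : F →* H)
    (hψ : ∀ m ∈ π.ker, ψ m ∈ Subgroup.center H) {v : Fin 3 → F} (hv : v ∈ groupKRel π.ker 3) :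
    (∀ i, v i ∈ π.ker) ∧ ψ (v 0) * ψ (v 1) * ψ (v 2) = 1 := by
  have hc {m : F} (hm : m ∈ π.ker) (g : H) : g * ψ m = ψ m * g :=
    Subgroup.mem_center_iff.mp (hψ m hm) g
  let S : Subgroup (Fin 3 → F) :=
    { carrier := {v | (∀ i, v i ∈ π.ker) ∧ ψ (v 0) * ψ (v 1) * ψ (v 2) = 1}
      one_mem' := ⟨fun i => one_mem _, by simp⟩
      mul_mem' := fun {v w} hv hw => ⟨fun i => mul_mem (hv.1 i) (hw.1 i), by
        have h1 := hc (hw.1 0) (ψ (v 2))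
        have h2 := hc (hw.1 0) (ψ (v 1))
        have h3 := hc (hw.1 1) (ψ (v 2))
        calc ψ (v 0 * w 0) * ψ (v 1 * w 1) * ψ (v 2 * w 2)
            = ψ (v 0) * (ψ (w 0) * ψ (v 1)) * (ψ (w 1) * ψ (v 2)) * ψ (w 2) := by
              simp only [map_mul, mul_assoc]
          _ = ψ (v 0) * ψ (v 1) * (ψ (w 0) * ψ (v 2)) * ψ (w 1) * ψ (w 2) := by
              rw [← h2, ← h3]; simp only [mul_assoc]
          _ = ψ (v 0) * ψ (v 1) * ψ (v 2) * (ψ (w 0) * ψ (w 1) * ψ (w 2)) := by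
              rw [← h1]; simp only [mul_assoc]
          _ = 1 := by rw [hv.2, hw.2, one_mul]⟩
      inv_mem' := fun {v} hv => ⟨fun i => inv_mem (hv.1 i), by
        have h1 := hc (hv.1 1) (ψ (v 0))
        have h2 := hc (hv.1 2) (ψ (v 0) * ψ (v 1))
        have h3 : ψ (v 2) * (ψ (v 1) * ψ (v 0)) = 1 := by rw [← h1, ← h2, hv.2]
        calc ψ (v 0)⁻¹ * ψ (v 1)⁻¹ * ψ (v 2)⁻¹ = (ψ (v 2) * (ψ (v 1) * ψ (v 0)))⁻¹ := by
              simp [mul_assoc]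
          _ = 1 := by rw [h3, inv_one]⟩ }
  have hS : S.Normal := by
    constructor
    intro v hv g
    refine ⟨fun i => π.normal_ker.conj_mem _ (hv.1 i) _, ?_⟩
    have h1 (i : Fin 3) : ψ ((g * v * g⁻¹) i) = ψ (v i) := by
      change ψ (g i * v i * (g i)⁻¹) = _
      rw [map_mul, map_mul, hc (hv.1 i), mul_assoc, ← map_mul, mul_inv_cancel, map_one, mul_one]
    rw [h1, h1, h1]
    exact hv.2
  refine Subgroup.normalClosure_le_normal (N := S) ?_ hv
  rintro _ ⟨g, hg, rfl⟩
  refine ⟨fun i => (g i).2, ?_⟩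
  let _ : CommGroup (Subgroup.center H) :=
    { (inferInstance : Group (Subgroup.center H)) with
      mul_comm := fun x y => Subtype.ext (Subgroup.mem_center_iff.mp y.2 x) }
  let χ : π.ker →* Subgroup.center H :=
    (ψ.comp π.ker.subtype).codRestrict _ fun m => hψ m m.2
  have h1 := congrArg (Abelianization.lift χ) (show abProd π.ker 3 g = 1 from hg)
  rw [map_one] at h1
  change Abelianization.lift χ (∏ i, Abelianization.of (g i)) = 1 at h1
  rw [map_prod, Fin.prod_univ_three] at h1
  simp only [Abelianization.lift_apply_of] at h1
  exact congrArg Subtype.val h1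

end Quotient

/-! ### The universal property and normal form of `τ(G)`. -/

section Tau

variable {G T : Type*} [Group G] [Group T]

/-- The homomorphism `G → τ(G)`, `g ↦ g`. -/
def Tau.left (G : Type*) [Group G] : G →* Tau G :=
  (QuotientGroup.mk' _).comp (Nu.left G)

/-- The homomorphism `G → τ(G)`, `g ↦ g*`. -/
def Tau.right (G : Type*) [Group G] : G →* Tau G :=
  (QuotientGroup.mk' _).comp (Nu.right G)

theorem Tau.isTauPair (G : Type*) [Group G] : IsTauPair (Tau.left G) (Tau.right G) where
  rconj_left x y z := by
    have h := congrArg (QuotientGroup.mk' (nabla G)) (Nu.rconj_left x y z)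
    simp only [map_rconj, map_rcomm] at h ⊢
    exact h
  rconj_right x y z := by
    have h := congrArg (QuotientGroup.mk' (nabla G)) (Nu.rconj_right x y z)
    simp only [map_rconj, map_rcomm] at h ⊢
    exact h
  rcomm_self x := (QuotientGroup.eq_one_iff (rcomm (Nu.left G x) (Nu.right G x))).mpr
    (Subgroup.subset_closure ⟨x, rfl⟩)

theorem IsTauPair.exists_lift {L R : G →* T} (h : IsTauPair L R) :
    ∃ Φ : Tau G →* T, (∀ g, Φ (Tau.left G g) = L g) ∧ ∀ g, Φ (Tau.right G g) = R g := by
  have h1 : Subgroup.normalClosure (nuRel G) ≤ (Monoid.Coprod.lift L R).ker := by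
    refine Subgroup.normalClosure_le_normal ?_
    rintro _ ⟨x, y, z, rfl | rfl⟩
    · change Monoid.Coprod.lift L R _ = 1
      rw [map_mul, map_inv, mul_inv_eq_one]
      simpa only [map_rconj, map_rcomm, Monoid.Coprod.lift_apply_inl,
        Monoid.Coprod.lift_apply_inr] using h.rconj_left x y z
    · change Monoid.Coprod.lift L R _ = 1
      rw [map_mul, map_inv, mul_inv_eq_one]
      simpa only [map_rconj, map_rcomm, Monoid.Coprod.lift_apply_inl,
        Monoid.Coprod.lift_apply_inr] using h.rconj_right x y z
  let Ψ : Nu G →* T := QuotientGroup.lift _ (Monoid.Coprod.lift L R) h1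
  have hl (g : G) : Ψ (Nu.left G g) = L g := Monoid.Coprod.lift_apply_inl L R g
  have hr (g : G) : Ψ (Nu.right G g) = R g := Monoid.Coprod.lift_apply_inr L R g
  have h2 : nabla G ≤ Ψ.ker := by
    rw [nabla, Subgroup.closure_le]
    rintro _ ⟨x, rfl⟩
    change Ψ _ = 1
    rw [map_rcomm, hl, hr, h.rcomm_self]
  exact ⟨QuotientGroup.lift _ Ψ h2, hl, hr⟩

theorem Tau.induction_on {P : Tau G → Prop} (hl : ∀ g, P (Tau.left G g))
    (hr : ∀ g, P (Tau.right G g)) (hm : ∀ s t, P s → P t → P (s * t)) (t : Tau G) : P t := by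
  obtain ⟨u, rfl⟩ := QuotientGroup.mk_surjective t
  obtain ⟨v, rfl⟩ := QuotientGroup.mk_surjective u
  induction v using Monoid.Coprod.induction_on with
  | inl z => exact hl z
  | inr z => exact hr z
  | mul a b ha hb => exact hm _ _ ha hb

theorem Tau.exists_normal_form {a b : G} (hgen : Subgroup.closure {a, b} = ⊤)
    (hab : rconj a b = a⁻¹) (t : Tau G) :
    ∃ k : ℤ, ∃ x y, t = rcomm (Tau.left G a) (Tau.right G b) ^ k * Tau.left G x * Tau.right G y := by
  suffices ∃ z ∈ Subgroup.zpowers (rcomm (Tau.left G a) (Tau.right G b)), ∃ x y,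
      t = z * Tau.left G x * Tau.right G y by
    obtain ⟨_, ⟨k, rfl⟩, x, y, e⟩ := this
    exact ⟨k, x, y, e⟩
  induction t using Tau.induction_on with
  | hl g => exact ⟨1, one_mem _, g, 1, by simp⟩
  | hr g => exact ⟨1, one_mem _, 1, g, by simp⟩
  | hm s t hs ht => exact (Tau.isTauPair G).exists_normal_form_mul hgen hab hs ht

end Tau

/-! ### The isomorphism between `τ(G)` and `K̃(G, 3)`. -/

/-- The quotient map `F³ → F³ / K(N, 3)^(F³)` identifies `K̃(G, 3)` with the image of `K(F, 3)`. -/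
theorem nonempty_KTilde_mulEquiv {F G : Type*} [Group F] [Group G] (π : F →* G) :
    Nonempty (KTilde π 3 ≃* (groupK F 3).map (QuotientGroup.mk' (groupKRel π.ker 3))) := by
  let f := (QuotientGroup.mk' (groupKRel π.ker 3)).comp (groupK F 3).subtype
  have h1 : (groupKRel π.ker 3).subgroupOf (groupK F 3) = f.ker := by
    rw [← MonoidHom.comap_ker, QuotientGroup.ker_mk']
    rfl
  have h2 : f.range = (groupK F 3).map (QuotientGroup.mk' (groupKRel π.ker 3)) := by
    rw [MonoidHom.range_comp, Subgroup.range_subtype]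
  exact ⟨(QuotientGroup.quotientMulEquivOfEq h1).trans
    ((QuotientGroup.quotientKerEquivRange f).trans (MulEquiv.subgroupCongr h2))⟩

theorem abProd_three {F : Type*} [Group F] (v : Fin 3 → F) : abProd F 3 v =
    Abelianization.of (v 0) * Abelianization.of (v 1) * Abelianization.of (v 2) :=
  Fin.prod_univ_three fun i => Abelianization.of (v i)

theorem coordHom_mul_mem_map {F : Type*} [Group F] (N : Subgroup F) {x y z : F}
    (h : Abelianization.of x * Abelianization.of y * Abelianization.of z = 1) :
    coordHom N 0 x * coordHom N 1 y * coordHom N 2 z ∈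
      (groupK F 3).map (QuotientGroup.mk' (groupKRel N 3)) :=
  ⟨![x, y, z], (abProd_three _).trans h, mk_eq_coordHom_mul N _⟩

namespace IsTwistedDiagonal

variable {F G : Type*} [Group F] [Group G] {π : F →* G} {φ : G →* G}
  {l r : G →* (Fin 3 → F) ⧸ groupKRel π.ker 3} {Φ : Tau G →* (Fin 3 → F) ⧸ groupKRel π.ker 3}

theorem range_eq (hφ : Function.Surjective φ)
    (hl : IsTwistedDiagonal π (coordHom π.ker) φ 0 l)
    (hr : IsTwistedDiagonal π (coordHom π.ker) φ 2 r)
    (hΦl : ∀ g, Φ (Tau.left G g) = l g) (hΦr : ∀ g, Φ (Tau.right G g) = r g) :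
    Φ.range = (groupK F 3).map (QuotientGroup.mk' (groupKRel π.ker 3)) := by
  have h := isCommutingTriple_coordHom π.ker
  apply le_antisymm
  · rintro _ ⟨t, rfl⟩
    induction t using Tau.induction_on with
    | hl g =>
      obtain ⟨p, q, h1, -, -, h4⟩ := hl.exists_form g
      rw [hΦl, h1, ← mul_one (coordHom _ 0 p * _), ← map_one (coordHom π.ker 2)]
      exact coordHom_mul_mem_map _ (by rw [map_one, mul_one, h4])
    | hr g =>
      obtain ⟨p, q, h1, -, -, h4⟩ := hr.exists_form g
      rw [hΦr, h1, (h.commute 2 1 (by decide) p q).eq, ← one_mul (coordHom _ 1 q),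
        ← map_one (coordHom π.ker 0)]
      exact coordHom_mul_mem_map _ (by rw [map_one, one_mul, mul_comm, h4])
    | hm s t hs ht =>
      rw [map_mul]
      exact mul_mem hs ht
  · have hmid : commutator F ≤ Φ.range.comap (coordHom π.ker 1) := by
      rw [commutator_eq_closure, Subgroup.closure_le]
      rintro _ ⟨x, y, rfl⟩
      -- The inverses arise because `⁅x, y⁆` is `rcomm x⁻¹ y⁻¹`.
      obtain ⟨s, hs⟩ := hφ (π x⁻¹)
      obtain ⟨t, ht⟩ := hφ (π y⁻¹)
      refine ⟨rcomm (Tau.left G s) (Tau.right G t), ?_⟩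
      rw [map_rcomm, hΦl, hΦr, rcomm_eq h hl hr hs.symm ht.symm]
      simp [rcomm, commutatorElement_def]
    -- Coordinate `i` is traded for coordinate `1`, keeping the class in `F / F'`.
    have key {i : Fin 3} (hi : i ≠ 1) {f : G →* (Fin 3 → F) ⧸ groupKRel π.ker 3}
        (hf : IsTwistedDiagonal π (coordHom π.ker) φ i f) (x : F) :
        ∃ u, coordHom π.ker i x = f (π x) * coordHom π.ker 1 u ∧
          Abelianization.of u = Abelianization.of x := by
      obtain ⟨p, q, h1, h2, -, h4⟩ := hf.exists_form (π x)
      refine ⟨q⁻¹ * (p⁻¹ * x), ?_, ?_⟩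
      · rw [map_mul, ← h.agree i 1 (p⁻¹ * x) (by simp [MonoidHom.mem_ker, h2]), h1, map_inv,
          mul_assoc, mul_inv_cancel_left, ← map_mul, mul_inv_cancel_left]
      · rw [map_mul, map_mul, ← mul_assoc, map_inv, map_inv, ← mul_inv_rev, h4, inv_one, one_mul]
    rintro _ ⟨v, hv, rfl⟩
    obtain ⟨u, hu, hu'⟩ := key (by decide) hl (v 0)
    obtain ⟨w, hw, hw'⟩ := key (by decide) hr (v 2)
    have hw2 : coordHom π.ker 2 (v 2) * (coordHom π.ker 1 w)⁻¹ = r (π (v 2)) := by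
      rw [hw, mul_inv_cancel_right]
    rw [← map_inv, (h.commute 2 1 (by decide) _ _).eq, map_inv, inv_mul_eq_iff_eq_mul] at hw2
    have hmem : u * v 1 * w ∈ commutator F := by
      rw [← Abelianization.ker_of, MonoidHom.mem_ker, map_mul, map_mul, hu', hw', ← abProd_three]
      exact hv
    obtain ⟨t, ht⟩ := hmid hmem
    refine ⟨Tau.left G (π (v 0)) * t * Tau.right G (π (v 2)), ?_⟩
    change _ = ((v : Fin 3 → F) : (Fin 3 → F) ⧸ groupKRel π.ker 3)
    rw [mk_eq_coordHom_mul, hu, hw2, map_mul, map_mul, hΦl, hΦr, ht, map_mul, map_mul]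
    simp only [mul_assoc]

theorem injective {H : Type*} [Group H] {a b : F}
    (hgen : Subgroup.closure {π a, π b} = ⊤) (hab : rconj (π a) (π b) = (π a)⁻¹)
    (hφa : φ (π a) = (π a)⁻¹) (hφb : φ (π b) = (π b)⁻¹) {n : ℕ} (hn : π b ^ 2 = π a ^ n)
    (ψ : F →* H) (hψ : ∀ m ∈ π.ker, ψ m ∈ Subgroup.center H)
    (hord : ∀ k : ℤ, ψ (rcomm a⁻¹ b⁻¹) ^ k = 1 → (n : ℤ) ∣ k)
    (hl : IsTwistedDiagonal π (coordHom π.ker) φ 0 l)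
    (hr : IsTwistedDiagonal π (coordHom π.ker) φ 2 r)
    (hΦl : ∀ g, Φ (Tau.left G g) = l g) (hΦr : ∀ g, Φ (Tau.right G g) = r g) :
    Function.Injective Φ := by
  have h := isCommutingTriple_coordHom π.ker
  have hmk {x y z : F} (e : coordHom π.ker 0 x * coordHom π.ker 1 y * coordHom π.ker 2 z = 1) :=
    groupKRel_le_of_map_ker_le_center ψ hψ (v := ![x, y, z])
      ((QuotientGroup.eq_one_iff _).mp ((mk_eq_coordHom_mul _ _).trans e))
  have hw : Φ (rcomm (Tau.left G (π a)) (Tau.right G (π b))) =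
      coordHom π.ker 1 (rcomm a⁻¹ b⁻¹) := by
    rw [map_rcomm, hΦl, hΦr, rcomm_eq h hl hr] <;> simp [*]
  rw [injective_iff_map_eq_one]
  intro t ht
  obtain ⟨k, x, y, rfl⟩ := Tau.exists_normal_form hgen hab t
  rw [map_mul, map_mul, map_zpow, hw, hΦl, hΦr, ← map_zpow] at ht
  obtain ⟨p, q, h1, h2, -, -⟩ := hl.exists_form x
  obtain ⟨p', q', h1', h2', -, -⟩ := hr.exists_form y
  have e1 : coordHom π.ker 0 p * coordHom π.ker 1 (rcomm a⁻¹ b⁻¹ ^ k * q * q') *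
      coordHom π.ker 2 p' = 1 := by
    rw [← ht, h1, h1', (h.commute 2 1 (by decide) _ _).eq, ← mul_assoc (coordHom _ 1 _),
      ← (h.commute 0 1 (by decide) _ _).eq, map_mul, map_mul]
    simp only [mul_assoc]
  -- A trivial element has all coordinates in `N`, and coordinates `0` and `2` lie over `x` and `y`.
  have hp : π p = 1 := (hmk e1).1 0
  have hp' : π p' = 1 := (hmk e1).1 2
  obtain rfl : x = 1 := h2.symm.trans hp
  obtain rfl : y = 1 := h2'.symm.trans hp'
  have e2 : coordHom π.ker 0 1 * coordHom π.ker 1 (rcomm a⁻¹ b⁻¹ ^ k) * coordHom π.ker 2 1 = 1 := by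
    rw [← ht]; simp
  have e3 := (hmk e2).2
  simp only [Matrix.cons_val, map_one, one_mul, mul_one, map_zpow] at e3
  obtain ⟨j, rfl⟩ := hord k e3
  rw [zpow_mul, zpow_natCast, (Tau.isTauPair G).pow_eq_one hab hn]
  simp

end IsTwistedDiagonal

theorem nonempty_tau_mulEquiv_KTilde.{u, v, w} {F : Type u} {G : Type v} {H : Type w} [Group F]
    [Group G] [Group H] {π : F →* G} (hπ : Function.Surjective π) {a b : F} {p n : ℕ}
    (hG : IsDicyclicPresented.{u} (π a) (π b) p n) {φ : G →* G}
    (hφa : φ (π a) = (π a)⁻¹) (hφb : φ (π b) = (π b)⁻¹)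
    (ψ : F →* H) (hψ : ∀ m ∈ π.ker, ψ m ∈ Subgroup.center H)
    (hord : ∀ k : ℤ, ψ (rcomm a⁻¹ b⁻¹) ^ k = 1 → (n : ℤ) ∣ k) :
    Nonempty (Tau G ≃* KTilde π 3) := by
  have h := isCommutingTriple_coordHom π.ker
  obtain ⟨l, hla, hlb⟩ := h.exists_hom (show (0 : Fin 3) ≠ 1 by decide) hG
  obtain ⟨r, hra, hrb⟩ := h.exists_hom (show (2 : Fin 3) ≠ 1 by decide) hG
  have hl : IsTwistedDiagonal π (coordHom π.ker) φ 0 l :=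
    ⟨h.exists_form (by decide) hG.closure hφa hφb hla hlb⟩
  have hr : IsTwistedDiagonal π (coordHom π.ker) φ 2 r :=
    ⟨h.exists_form (by decide) hG.closure hφa hφb hra hrb⟩
  obtain ⟨Φ, hΦl, hΦr⟩ := (IsTwistedDiagonal.isTauPair h hπ hl hr).exists_lift
  have hφ : Function.Surjective φ := by
    intro g
    refine ⟨φ g, mem_of_closure_pair_eq_top hG.closure
      ((φ.comp φ).eqLocus (MonoidHom.id G)) ?_ ?_ g⟩
    · change φ (φ (π a)) = π a
      rw [hφa, map_inv, hφa, inv_inv]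
    · change φ (φ (π b)) = π b
      rw [hφb, map_inv, hφb, inv_inv]
  have hinj : Function.Injective Φ := IsTwistedDiagonal.injective hG.closure hG.conj_eq hφa hφb
    hG.sq_eq ψ hψ hord hl hr hΦl hΦr
  obtain ⟨e⟩ := nonempty_KTilde_mulEquiv π
  exact ⟨((MonoidHom.ofInjective hinj).trans (MulEquiv.subgroupCongr
    (IsTwistedDiagonal.range_eq hφ hl hr hΦl hΦr))).trans e.symm⟩

/-! ### The presentations of the dihedral and quaternion groups. -/

section DicyclicRelations

variable {Q : Type*} [Group Q]

/-- The powers of an element `A` with `A ^ p = 1`, indexed by `ZMod p`. -/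
def zmodPow {p : ℕ} (A : Q) (hA : A ^ p = 1) (i : ZMod p) : Q :=
  (ZMod.lift p ⟨zmultiplesHom (Additive Q) (Additive.ofMul A), by
    simpa [← ofMul_pow] using hA⟩ i).toMul

theorem zmodPow_intCast {p : ℕ} (A : Q) (hA : A ^ p = 1) (k : ℤ) :
    zmodPow A hA (k : ZMod p) = A ^ k := by
  rw [zmodPow, ZMod.lift_coe]
  rfl

theorem zmodPow_add {p : ℕ} (A : Q) (hA : A ^ p = 1) (i j : ZMod p) :
    zmodPow A hA (i + j) = zmodPow A hA i * zmodPow A hA j := by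
  rw [zmodPow, map_add]
  rfl

theorem zmodPow_mul_eq {p : ℕ} {A B : Q} (hA : A ^ p = 1) (hAB : rconj A B = A⁻¹) (i : ZMod p) :
    zmodPow A hA i * B = B * zmodPow A hA (-i) := by
  obtain ⟨k, rfl⟩ := ZMod.intCast_surjective i
  rw [← Int.cast_neg, zmodPow_intCast, zmodPow_intCast, zpow_neg, ← inv_zpow, ← hAB]
  have := conj_zpow (i := k) (a := B⁻¹) (b := A)
  rw [inv_inv] at this
  rw [rconj, this]
  group

end DicyclicRelations

namespace DihedralGroup

theorem isDicyclicPresented (n : ℕ) :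
    IsDicyclicPresented (r 1 : DihedralGroup n) (sr 0) n n where
  closure := by
    rw [eq_top_iff]
    have ha (i : ZMod n) : r i ∈ Subgroup.closure {(r 1 : DihedralGroup n), sr 0} := by
      obtain ⟨k, rfl⟩ := ZMod.intCast_surjective i
      rw [← r_one_zpow]
      exact zpow_mem (Subgroup.subset_closure (by simp)) k
    rintro (i | i) -
    · exact ha i
    · rw [show sr i = (sr 0 : DihedralGroup n) * r i by simp]
      exact mul_mem (Subgroup.subset_closure (by simp)) (ha i)
  pow_eq_one := r_one_pow_n
  sq_eq := by rw [sq, sr_mul_self, r_one_pow_n]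
  conj_eq := by simp [rconj]
  exists_lift {Q} _ A B hA hB hAB := by
    refine ⟨MonoidHom.mk' (fun g => match g with
      | r i => zmodPow A hA i
      | sr i => B * zmodPow A hA i) ?_, ?_, ?_⟩
    · rw [hA] at hB
      rintro (i | i) (j | j)
      · exact zmodPow_add A hA i j
      · change B * zmodPow A hA (j - i) = zmodPow A hA i * (B * zmodPow A hA j)
        rw [← mul_assoc, zmodPow_mul_eq hA hAB, mul_assoc, ← zmodPow_add, sub_eq_neg_add]
      · change B * zmodPow A hA (i + j) = B * zmodPow A hA i * zmodPow A hA j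
        rw [zmodPow_add, mul_assoc]
      · change zmodPow A hA (j - i) = B * zmodPow A hA i * (B * zmodPow A hA j)
        rw [mul_assoc, ← mul_assoc _ B, zmodPow_mul_eq hA hAB, mul_assoc, ← zmodPow_add,
          ← mul_assoc, ← sq, hB, one_mul, sub_eq_neg_add]
    · change zmodPow A hA 1 = A
      rw [← Int.cast_one, zmodPow_intCast, zpow_one]
    · change B * zmodPow A hA 0 = B
      rw [← Int.cast_zero, zmodPow_intCast, zpow_zero, mul_one]

theorem exists_inverting_hom (n : ℕ) :
    ∃ φ : DihedralGroup n →* DihedralGroup n, φ (r 1) = (r 1)⁻¹ ∧ φ (sr 0) = (sr 0)⁻¹ := by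
  have h := isDicyclicPresented n
  refine h.exists_lift _ _ (by rw [inv_pow, h.pow_eq_one, inv_one])
    (by rw [inv_pow, inv_pow, h.sq_eq]) (by simp [rconj])

end DihedralGroup

namespace QuaternionGroup

theorem a_one_zpow {n : ℕ} (k : ℤ) : (a 1 : QuaternionGroup n) ^ k = a k := by
  cases k with
  | ofNat k => simp
  | negSucc k =>
    rw [zpow_negSucc, a_one_pow, inv_eq_iff_mul_eq_one]
    rw [a_mul_a, ← a_zero, Int.cast_negSucc, add_neg_cancel]

theorem isDicyclicPresented (n : ℕ) :
    IsDicyclicPresented (a 1 : QuaternionGroup n) (xa 0) (2 * n) n where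
  closure := by
    rw [eq_top_iff]
    have ha (i : ZMod (2 * n)) : a i ∈ Subgroup.closure {(a 1 : QuaternionGroup n), xa 0} := by
      obtain ⟨k, rfl⟩ := ZMod.intCast_surjective i
      rw [← a_one_zpow]
      exact zpow_mem (Subgroup.subset_closure (by simp)) k
    rintro (i | i) -
    · exact ha i
    · rw [show xa i = (xa 0 : QuaternionGroup n) * a i by simp]
      exact mul_mem (Subgroup.subset_closure (by simp)) (ha i)
  pow_eq_one := a_one_pow_n
  sq_eq := by rw [xa_sq, a_one_pow]
  conj_eq := by
    have h : (xa 0 : QuaternionGroup n) * (a 1)⁻¹ = a 1 * xa 0 := by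
      rw [mul_inv_eq_iff_eq_mul]; simp
    rw [rconj, mul_assoc, ← h, inv_mul_cancel_left]
  exists_lift {Q} _ A B hA hB hAB := by
    refine ⟨MonoidHom.mk' (fun g => match g with
      | a i => zmodPow A hA i
      | xa i => B * zmodPow A hA i) ?_, ?_, ?_⟩
    · have hn : zmodPow A hA (n : ZMod (2 * n)) = B * B := by
        rw [← Int.cast_natCast, zmodPow_intCast, zpow_natCast, ← hB, sq]
      rintro (i | i) (j | j)
      · exact zmodPow_add A hA i j
      · change B * zmodPow A hA (j - i) = zmodPow A hA i * (B * zmodPow A hA j)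
        rw [← mul_assoc, zmodPow_mul_eq hA hAB, mul_assoc, ← zmodPow_add, sub_eq_neg_add]
      · change B * zmodPow A hA (i + j) = B * zmodPow A hA i * zmodPow A hA j
        rw [zmodPow_add, mul_assoc]
      · change zmodPow A hA (n + j - i) = B * zmodPow A hA i * (B * zmodPow A hA j)
        rw [mul_assoc, ← mul_assoc _ B, zmodPow_mul_eq hA hAB, mul_assoc, ← zmodPow_add,
          ← mul_assoc, ← hn, ← zmodPow_add]
        congr 1; ring
    · change zmodPow A hA 1 = A
      rw [← Int.cast_one, zmodPow_intCast, zpow_one]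
    · change B * zmodPow A hA 0 = B
      rw [← Int.cast_zero, zmodPow_intCast, zpow_zero, mul_one]

theorem exists_inverting_hom (n : ℕ) :
    ∃ φ : QuaternionGroup n →* QuaternionGroup n, φ (a 1) = (a 1)⁻¹ ∧ φ (xa 0) = (xa 0)⁻¹ := by
  have h := isDicyclicPresented n
  refine h.exists_lift _ _ (by rw [inv_pow, h.pow_eq_one, inv_one])
    (by rw [inv_pow, inv_pow, h.sq_eq]) ?_
  have h1 := h.conj_eq
  rw [rconj, mul_assoc, inv_mul_eq_iff_eq_mul] at h1
  rw [rconj, inv_inv, inv_inv, ← h1, mul_inv_cancel_right]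

/-- Central factors drop out of the commutator, leaving `a 1 ^ 2`, while `a 1` has order `2 * n`. -/
theorem rcomm_inv_zpow_eq_one {n : ℕ} {k : ℤ} {u v z z' : QuaternionGroup n}
    (hu : u = a 1 * z) (hv : v = xa 0 * z') (hz : z ∈ Subgroup.center (QuaternionGroup n))
    (hz' : z' ∈ Subgroup.center (QuaternionGroup n)) (hk : rcomm u⁻¹ v⁻¹ ^ k = 1) :
    (n : ℤ) ∣ k := by
  have hc (y : QuaternionGroup n) : Commute z⁻¹ y :=
    (Subgroup.mem_center_iff.mp (inv_mem hz) y).symm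
  have hc' (y : QuaternionGroup n) : Commute z'⁻¹ y :=
    (Subgroup.mem_center_iff.mp (inv_mem hz') y).symm
  have h1 := (isDicyclicPresented.{0} n).conj_eq
  rw [rconj, mul_assoc, inv_mul_eq_iff_eq_mul] at h1
  have h2 : rcomm u⁻¹ v⁻¹ = a 1 ^ (2 : ℤ) := by
    rw [hu, hv, mul_inv_rev, mul_inv_rev, (hc _).eq, (hc' _).eq, rcomm_mul_left,
      rcomm_eq_one_iff.mpr (hc _), mul_one, rconj_eq_self_iff.mpr (hc _), rcomm_mul_right,
      rcomm_eq_one_iff.mpr (hc' _).symm, one_mul, rconj_eq_self_iff.mpr (hc' _), rcomm, inv_inv,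
      inv_inv, mul_assoc (a 1), ← h1, ← mul_assoc, mul_inv_cancel_right, zpow_two]
  rw [h2, ← zpow_mul, ← orderOf_dvd_iff_zpow_eq_one, orderOf_a_one, Nat.cast_mul] at hk
  exact (mul_dvd_mul_iff_left two_ne_zero).mp hk

/-- In `ZMod (2 * n)` one has `n = -n`, so inversion fixes `a n`. -/
theorem a_natCast_mem_center (n : ℕ) :
    (a n : QuaternionGroup n) ∈ Subgroup.center (QuaternionGroup n) := by
  have h : (n : ZMod (2 * n)) + n = 0 := by
    rw [← two_mul]
    exact_mod_cast ZMod.natCast_self (2 * n)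
  rw [Subgroup.mem_center_iff]
  rintro (i | i)
  · rw [a_mul_a, a_mul_a, add_comm]
  · rw [xa_mul_a, a_mul_xa, sub_eq_add_neg, ← eq_neg_of_add_eq_zero_left h]

/-- The quotient of the quaternion group of order `4 n` by its central subgroup of order two. -/
theorem exists_hom_dihedralGroup (n : ℕ) : ∃ f : QuaternionGroup n →* DihedralGroup n,
    f (a 1) = DihedralGroup.r 1 ∧ f (xa 0) = DihedralGroup.sr 0 ∧
      Function.Surjective f ∧ f.ker ≤ Subgroup.center (QuaternionGroup n) := by
  have h := DihedralGroup.isDicyclicPresented.{0} n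
  obtain ⟨f, ha, hb⟩ := (isDicyclicPresented n).exists_lift _ _
    (by rw [mul_comm, pow_mul, h.pow_eq_one, one_pow]) h.sq_eq h.conj_eq
  refine ⟨f, ha, hb, fun g => mem_of_closure_pair_eq_top h.closure f.range ⟨_, ha⟩ ⟨_, hb⟩ g,
    ?_⟩
  have hf (k : ℤ) : f (a k) = DihedralGroup.r k := by
    rw [← a_one_zpow, map_zpow, ha, DihedralGroup.r_one_zpow]
  rintro (i | i) hi
  · obtain ⟨k, rfl⟩ := ZMod.intCast_surjective i
    rw [MonoidHom.mem_ker, hf, ← DihedralGroup.r_one_zpow, ← orderOf_dvd_iff_zpow_eq_one,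
      DihedralGroup.orderOf_r_one] at hi
    obtain ⟨j, rfl⟩ := hi
    rw [← a_one_zpow, zpow_mul, a_one_zpow, Int.cast_natCast]
    exact zpow_mem (a_natCast_mem_center n) j
  · obtain ⟨k, rfl⟩ := ZMod.intCast_surjective i
    rw [MonoidHom.mem_ker, show xa (k : ZMod (2 * n)) = (xa 0 : QuaternionGroup n) * a k by simp,
      map_mul, hf, hb, DihedralGroup.sr_mul_r, DihedralGroup.one_def] at hi
    cases hi

end QuaternionGroup

theorem mainTheorem9 (n : ℕ) (hn : 1 ≤ n) :
    (∀ (X : Type*) (π : FreeGroup X →* QuaternionGroup n), Function.Surjective π →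
      Nonempty (Tau (QuaternionGroup n) ≃* KTilde π 3)) ∧
    (∀ (X : Type*) (π : FreeGroup X →* DihedralGroup n), Function.Surjective π →
      Nonempty (Tau (DihedralGroup n) ≃* KTilde π 3)) := by
  constructor
  · intro X π hπ
    obtain ⟨a, ha⟩ := hπ (QuaternionGroup.a 1)
    obtain ⟨b, hb⟩ := hπ (QuaternionGroup.xa 0)
    obtain ⟨φ, hφa, hφb⟩ := QuaternionGroup.exists_inverting_hom n
    rw [← ha] at hφa
    rw [← hb] at hφb
    refine nonempty_tau_mulEquiv_KTilde hπ (a := a) (b := b) (p := 2 * n) (n := n)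
      (by rw [ha, hb]; exact QuaternionGroup.isDicyclicPresented n) hφa hφb π ?_ ?_
    · intro m hm
      rw [show π m = 1 from hm]
      exact one_mem _
    · intro k hk
      rw [map_rcomm, map_inv, map_inv] at hk
      exact QuaternionGroup.rcomm_inv_zpow_eq_one (z := 1) (z' := 1) (by rw [ha, mul_one])
        (by rw [hb, mul_one]) (one_mem _) (one_mem _) hk
  · intro X π hπ
    obtain ⟨a, ha⟩ := hπ (DihedralGroup.r 1)
    obtain ⟨b, hb⟩ := hπ (DihedralGroup.sr 0)
    obtain ⟨φ, hφa, hφb⟩ := DihedralGroup.exists_inverting_hom n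
    rw [← ha] at hφa
    rw [← hb] at hφb
    obtain ⟨f, hfa, hfb, hf, hker⟩ := QuaternionGroup.exists_hom_dihedralGroup n
    choose s hs using hf
    -- For even `n` the square of `r 1` has order only `n / 2`, so `π` would not detect `n ∣ k`.
    -- Freeness lifts it through `f`, sending `π.ker` into the central subgroup `f.ker`.
    let ψ : FreeGroup X →* QuaternionGroup n := FreeGroup.lift fun x => s (π (FreeGroup.of x))
    have hψ (w : FreeGroup X) : f (ψ w) = π w := by
      have : f.comp ψ = π := FreeGroup.ext_hom _ _ fun x => by simp [ψ, hs]
      exact DFunLike.congr_fun this w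
    refine nonempty_tau_mulEquiv_KTilde hπ (a := a) (b := b) (p := n) (n := n)
      (by rw [ha, hb]; exact DihedralGroup.isDicyclicPresented n) hφa hφb ψ ?_ ?_
    · intro m hm
      exact hker ((hψ m).trans hm)
    · intro k hk
      rw [map_rcomm, map_inv, map_inv] at hk
      refine QuaternionGroup.rcomm_inv_zpow_eq_one (z := (QuaternionGroup.a 1)⁻¹ * ψ a)
        (z' := (QuaternionGroup.xa 0)⁻¹ * ψ b) (by group) (by group) (hker ?_) (hker ?_) hk
      · rw [MonoidHom.mem_ker, map_mul, map_inv, hψ, hfa, ha, inv_mul_cancel]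
      · rw [MonoidHom.mem_ker, map_mul, map_inv, hψ, hfb, hb, inv_mul_cancel]
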